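/- Theorem 2. For $x\in(0,1)$ irrational put $A(x)=\{1/x\}$ and $A_0(x)=\lfloor 1/x+1\rfloor-1/x$, and for irrational $x\in\mathbf{R}$ with fractional part $\{x\}$ let $$W(x)=\sum_{j\ge 0}(-1)^j\,\{x\}A(\{x\})\cdots A^{j-1}(\{x\})\,\log\frac{1}{A^j(\{x\})},\qquad B_0(x)=\sum_{j\ge 0}\{x\}A_0(\{x\})\cdots A_0^{j-1}(\{x\})\,\log\frac{1}{A_0^j(\{x\})}$$ be the Wilton function and the semi-Brjuno function, wherever the series converge. Let $W^-(x)=\frac12(W(x)-W(-x))$, $B_0^-(x)=\frac12(B_0(x)-B_0(-x))$ and $\Delta^-(x)=W^-(x)-2B_0^-(x)$, which is defined on the set $\mathcal{D}$ of all irrational $x$ at which the series for $W(x)$, $W(-x)$, $B_0(x)$ and $B_0(-x)$ all converge. Then $\mathcal{D}$ is dense in $\mathbf{R}$, and $\Delta^-$ extends from $\mathcal{D}$ to a (necessarily unique) continuous function on $\mathbf{R}\setminus\mathbf{Q}$, in particular on $(0,\frac12)\setminus\mathbf{Q}$, again denoted by $\Delta^-$, such that: (i) at every rational $p/q$ (in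 lowest terms, $q\ge1$) the one-sided limits of $\Delta^-$ along irrationals exist, and $\Delta^-(p/q^+)-\Delta^-(p/q^-)=\frac2q$; (ii) every extension of $\Delta^-$ to $\mathbf{R}$ whose value at each rational $p/q$ lies in $[\Delta^-(p/q^-),\Delta^-(p/q^+)]$ is Riemann integrable on every compact interval $[a,b]$ with $a<b$; (iii) $\Delta^-$ is nowhere differentiable: for every $x\in\mathbf{R}$, whatever value is assigned at $x$ if $x$ is rational, the difference quotients of $\Delta^-$ at $x$, taken along irrationals, do not converge to a finite limit. -/

import Mathlib

open Filter Topology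

noncomputable section

/-- The Gauss map `A(x) = {1/x}`. -/
def gaussMap (x : ℝ) : ℝ := Int.fract (1 / x)

/-- The by-excess map `A₀(x) = ⌊1/x + 1⌋ - 1/x`. -/
def byExcessMap (x : ℝ) : ℝ := (⌊1 / x + 1⌋ : ℝ) - 1 / x

/-- The `j`-th term `y T(y) ⋯ T^{j-1}(y) · log (1 / T^j(y))`, with `y = {x}`, of the Brjuno-type
series attached to the map `T`. -/
def brjunoTerm (T : ℝ → ℝ) (x : ℝ) (j : ℕ) : ℝ :=
  (∏ i ∈ Finset.range j, T^[i] (Int.fract x)) * Real.log (1 / T^[j] (Int.fract x))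

/-- The `j`-th term of the series defining the Wilton function. -/
def wiltonTerm (x : ℝ) (j : ℕ) : ℝ := (-1) ^ j * brjunoTerm gaussMap x j

/-- Convergence (of the sequence of partial sums) of the series defining `W(x)`. -/
def WiltonConverges (x : ℝ) : Prop :=
  Summable (wiltonTerm x) (SummationFilter.conditional ℕ)

/-- The Wilton function `W`: the limit of the partial sums of its series. -/
def wilton (x : ℝ) : ℝ := ∑'[SummationFilter.conditional ℕ] j, wiltonTerm x j

/-- Convergence (of the sequence of partial sums) of the series defining `B₀(x)`. -/
def SemiBrjunoConverges (x : ℝ) : Prop :=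
  Summable (brjunoTerm byExcessMap x) (SummationFilter.conditional ℕ)

/-- The semi-Brjuno function `B₀`: the limit of the partial sums of its series. -/
def semiBrjuno (x : ℝ) : ℝ := ∑'[SummationFilter.conditional ℕ] j, brjunoTerm byExcessMap x j

/-- The odd part of a function on `ℝ`. -/
def oddPart (f : ℝ → ℝ) (x : ℝ) : ℝ := (f x - f (-x)) / 2

/-- `Δ⁻ = W⁻ - 2 B₀⁻`; meaningful at the points of `deltaMinusDomain`. -/
def deltaMinus (x : ℝ) : ℝ := oddPart wilton x - 2 * oddPart semiBrjuno x

/-- The irrational points at which all four series entering `Δ⁻(x)` converge. -/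
def deltaMinusDomain : Set ℝ :=
  {x | Irrational x ∧ WiltonConverges x ∧ WiltonConverges (-x) ∧
    SemiBrjunoConverges x ∧ SemiBrjunoConverges (-x)}

/-- Riemann integrability of `F` on `[a, b]`: Mathlib's Riemann integral over boxes, for the
one-dimensional box with end points `a < b` and the usual length. -/
def RiemannIntegrableOn (F : ℝ → ℝ) (a b : ℝ) (hab : a < b) : Prop :=
  BoxIntegral.Integrable
    (⟨fun _ => a, fun _ => b, fun _ => hab⟩ : BoxIntegral.Box (Fin 1))
    BoxIntegral.IntegrationParams.Riemann (fun v => F (v 0))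
    (BoxIntegral.BoxAdditiveMap.volume : BoxIntegral.BoxAdditiveMap (Fin 1) (ℝ →L[ℝ] ℝ) ⊤)

end

/-!
The function `G(x) = W(x) - B₀(x) + B₀(-x)` satisfies `G(x) = H(x) - x G(A(x))` on `(0, 1)`, where
`H(y) = y (g(1/y) + φ({1/y}))`, `g(u) = u log u - log Γ(u)` and `φ(t) = log t - g(t)`: the
by-excess orbit of `-x` takes `⌊1/x⌋` steps to reach that of `-A²(x)`, and the logarithms met on
the way telescope to values of `log Γ`. Now `H` is continuous on `[0, 1]` with `H(0) = 1` and
`H(1) = 0`, so the equation has the bounded solution `F = ∑ (-1)ᵏ x A(x) ⋯ Aᵏ⁻¹(x) H(Aᵏ(x))`. It is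
continuous at the irrational numbers, and by induction on the denominator it jumps by
`(2 H(0) - H(1)) / q` at `p/q`. Iterating the equation for `G - F` an even number of times leaves
tails of the convergent series `W(x)`, `B₀(x)`, `B₀(-x)` and a bounded multiple of
`x A(x) ⋯ A²ᵐ⁻¹(x)`, which all vanish in the limit; hence `G = F`. Finally `W(x) + W(-x)` is an
elementary continuous function of the distance from `x` to the nearest integer, and `Δ⁻` is `F`
minus half of it.

An extension of `Δ⁻` whose values lie between the one-sided limits is discontinuous only on `ℚ`,
hence Riemann integrable by Lebesgue's criterion. It is nowhere differentiable, because
differentiability at `x` would make the jump at `a` be `o(|a - x|)`, which fails along the Dirichlet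
approximations `a = p/q` of `x`. The domain of `Δ⁻` is dense because it contains the golden ratio
and is stable under integer translations and inversion.
-/
section SideLimits

open Set

/-- `l` and `r` are the left and the right limit of `f` at `a` along the set `S`. -/
structure HasSideLimitsWithin {α β : Type*} [TopologicalSpace α] [Preorder α] [TopologicalSpace β]
    (f : α → β) (S : Set α) (a : α) (l r : β) : Prop where
  left : Tendsto f (𝓝[S ∩ Iio a] a) (𝓝 l)
  right : Tendsto f (𝓝[S ∩ Ioi a] a) (𝓝 r)

lemma HasSideLimitsWithin.congr {α β : Type*} [TopologicalSpace α] [Preorder α]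
    [TopologicalSpace β] {f g : α → β} {S : Set α} {a : α} {l r : β}
    (h : HasSideLimitsWithin f S a l r) (hfg : EqOn f g S) : HasSideLimitsWithin g S a l r where
  left := h.left.congr' ((hfg.mono inter_subset_left).eventuallyEq_nhdsWithin)
  right := h.right.congr' ((hfg.mono inter_subset_left).eventuallyEq_nhdsWithin)

section Order

variable {α : Type*} [TopologicalSpace α] [LinearOrder α] [OrderTopology α] [DenselyOrdered α]
  {S : Set α}

lemma nhdsWithin_inter_Iio_neBot [NoMinOrder α] (hS : Dense S) (a : α) :
    (𝓝[S ∩ Iio a] a).NeBot := by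
  have hsub : closure (Iio a) ⊆ closure (S ∩ Iio a) :=
    closure_minimal
      (inter_comm S (Iio a) ▸ hS.open_subset_closure_inter isOpen_Iio) isClosed_closure
  exact mem_closure_iff_nhdsWithin_neBot.1 (hsub (closure_Iio a ▸ self_mem_Iic))

lemma nhdsWithin_inter_Ioi_neBot [NoMaxOrder α] (hS : Dense S) (a : α) :
    (𝓝[S ∩ Ioi a] a).NeBot := by
  have hsub : closure (Ioi a) ⊆ closure (S ∩ Ioi a) :=
    closure_minimal
      (inter_comm S (Ioi a) ▸ hS.open_subset_closure_inter isOpen_Ioi) isClosed_closure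
  exact mem_closure_iff_nhdsWithin_neBot.1 (hsub (closure_Ioi a ▸ self_mem_Ici))

lemma HasSideLimitsWithin.mem_of_eventually_mem {β : Type*} [TopologicalSpace β] [Preorder β]
    [NoMinOrder α] [NoMaxOrder α] (hS : Dense S) {f : α → β} {a : α} {l r y : β} {K : Set β}
    (h : HasSideLimitsWithin f S a l r) (hy : y ∈ Icc l r) (hK : IsClosed K)
    (hKc : K.OrdConnected) (hf : ∀ᶠ z in 𝓝[S] a, f z ∈ K) : y ∈ K := by
  have := nhdsWithin_inter_Iio_neBot hS a
  have := nhdsWithin_inter_Ioi_neBot hS a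
  have hl : l ∈ K := hK.mem_of_tendsto h.left (hf.filter_mono (nhdsWithin_mono a inter_subset_left))
  have hr : r ∈ K :=
    hK.mem_of_tendsto h.right (hf.filter_mono (nhdsWithin_mono a inter_subset_left))
  exact hKc.out hl hr hy

end Order

variable {f : ℝ → ℝ} {S : Set ℝ} {x : ℝ}

lemma continuousAt_of_mem_Icc_sideLimits (hS : Dense S) (hf : ContinuousWithinAt f S x)
    (hlim : ∀ a ∉ S, ∃ l r, HasSideLimitsWithin f S a l r ∧ f a ∈ Icc l r) :
    ContinuousAt f x := by
  refine Metric.nhds_basis_closedBall.tendsto_right_iff.2 fun ε hε => ?_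
  have hball : ∀ᶠ y in 𝓝[S] x, f y ∈ Metric.closedBall (f x) ε :=
    hf.eventually (Metric.closedBall_mem_nhds _ hε)
  filter_upwards [eventually_eventually_nhds.2 (eventually_nhdsWithin_iff.1 hball)] with y hy
  by_cases hyS : y ∈ S
  · exact hy.self_of_nhds hyS
  · obtain ⟨l, r, hlr, hmem⟩ := hlim y hyS
    refine hlr.mem_of_eventually_mem hS hmem Metric.isClosed_closedBall ?_
      (eventually_nhdsWithin_iff.2 hy)
    rw [Real.closedBall_eq_Icc]
    exact ordConnected_Icc

theorem riemannIntegrableOn_of_bounded_of_ae_continuousAt {a b B : ℝ} (hab : a < b)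
    (hB : ∀ y ∈ Icc a b, |f y| ≤ B) (hf : ∀ᵐ y, ContinuousAt f y) :
    RiemannIntegrableOn f a b hab := by
  refine BoxIntegral.integrable_of_bounded_and_ae_continuous (I := ⟨_, _, fun _ => hab⟩)
    BoxIntegral.IntegrationParams.Riemann (f := fun v : Fin 1 → ℝ => f (v 0))
    ⟨B, fun v hv => hB (v 0) ⟨hv.1 0, hv.2 0⟩⟩ MeasureTheory.volume ?_
  filter_upwards [(MeasureTheory.volume_preserving_funUnique (Fin 1) ℝ).quasiMeasurePreserving.ae
    hf] with v hv
  exact ContinuousAt.comp (f := fun v : Fin 1 → ℝ => v 0) hv (continuous_apply 0).continuousAt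

theorem riemannIntegrableOn_of_mem_Icc_sideLimits {a b B : ℝ} (hab : a < b)
    (hS : ∀ᵐ y, y ∈ S) (hf : ContinuousOn f S) (hB : ∀ y ∈ S, |f y| ≤ B)
    (hlim : ∀ y ∉ S, ∃ l r, HasSideLimitsWithin f S y l r ∧ f y ∈ Icc l r) :
    RiemannIntegrableOn f a b hab := by
  have hdense : Dense S := MeasureTheory.Measure.dense_of_ae hS
  refine riemannIntegrableOn_of_bounded_of_ae_continuousAt (B := B) hab (fun y _ => ?_) ?_
  · by_cases hy : y ∈ S
    · exact hB y hy
    · obtain ⟨l, r, hlr, hmem⟩ := hlim y hy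
      exact abs_le.2 (hlr.mem_of_eventually_mem hdense hmem isClosed_Icc ordConnected_Icc
        (eventually_nhdsWithin_of_forall fun z hz => abs_le.1 (hB z hz)))
  · filter_upwards [hS] with y hy
    exact continuousAt_of_mem_Icc_sideLimits hdense (hf y hy) hlim

lemma eventually_abs_sub_sideLimits_le (hS : Dense S) (hf : DifferentiableWithinAt ℝ f S x)
    {ε : ℝ} (hε : 0 < ε) :
    ∀ᶠ a in 𝓝 x, ∀ l r, HasSideLimitsWithin f S a l r → |r - l| ≤ ε * |a - x| := by
  set f' := derivWithin f S x
  have hlin : ∀ᶠ z in 𝓝[S] x, |f z - f x - (z - x) * f'| ≤ ε / 2 * |z - x| :=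
    (hasDerivWithinAt_iff_isLittleO.1 hf.hasDerivWithinAt).def (half_pos hε)
  filter_upwards [eventually_eventually_nhds.2 (eventually_nhdsWithin_iff.1 hlin)]
    with a ha l r hlr
  have hlimit : ∀ (T : Set ℝ) (c : ℝ), (𝓝[S ∩ T] a).NeBot → Tendsto f (𝓝[S ∩ T] a) (𝓝 c) →
      |c - f x - (a - x) * f'| ≤ ε / 2 * |a - x| := by
    intro T c _ hc
    have hid : Tendsto (fun z => z) (𝓝[S ∩ T] a) (𝓝 a) := tendsto_id.mono_left nhdsWithin_le_nhds
    have hz : ∀ᶠ z in 𝓝[S ∩ T] a, |f z - f x - (z - x) * f'| ≤ ε / 2 * |z - x| :=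
      (eventually_nhdsWithin_iff.2 ha).filter_mono (nhdsWithin_mono a inter_subset_left)
    exact le_of_tendsto_of_tendsto ((hc.sub_const _).sub ((hid.sub_const x).mul_const f')).abs
      ((hid.sub_const x).abs.const_mul _) hz
  have hl := hlimit _ l (nhdsWithin_inter_Iio_neBot hS a) hlr.left
  have hr := hlimit _ r (nhdsWithin_inter_Ioi_neBot hS a) hlr.right
  rw [abs_le] at hl hr ⊢
  constructor <;> linarith

theorem not_differentiableWithinAt_of_jump_eq_div_den (hS : Dense S) {c : ℝ} (hc : c ≠ 0)
    (hjump : ∀ q : ℚ, ∃ l r, HasSideLimitsWithin f S q l r ∧ r - l = c / q.den) (x : ℝ) :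
    ¬ DifferentiableWithinAt ℝ f S x := by
  intro hd
  have hc2 : 0 < |c| / 2 := by positivity
  obtain ⟨δ, hδ, hball⟩ := Metric.eventually_nhds_iff.1 (eventually_abs_sub_sideLimits_le hS hd hc2)
  obtain ⟨n, hn⟩ := exists_nat_one_div_lt hδ
  -- Dirichlet: the jump at `q` is at least `|c| * |x - q|`.
  obtain ⟨q, hq, -⟩ := Real.exists_rat_abs_sub_le_and_den_le x n.succ_pos
  have hden : (1 : ℝ) ≤ q.den := by exact_mod_cast q.den_pos
  have hdist : |x - q| ≤ 1 / (n + 1) := hq.trans (by push_cast; gcongr; nlinarith)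
  have hqden : |x - q| ≤ 1 / q.den := hq.trans (by push_cast; gcongr; nlinarith)
  obtain ⟨l, r, hlr, hrl⟩ := hjump q
  have hle : |r - l| ≤ |c| / 2 * |(q : ℝ) - x| :=
    hball (by rw [dist_comm, Real.dist_eq]; linarith) l r hlr
  rw [hrl, abs_div, Nat.abs_cast, abs_sub_comm] at hle
  have hpos : 0 < |c| / q.den := by positivity
  have hlt : |c| / 2 * |x - q| ≤ |c| / q.den / 2 := calc
    |c| / 2 * |x - q| ≤ |c| / 2 * (1 / q.den) := by gcongr
    _ = |c| / q.den / 2 := by ring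
  linarith

end SideLimits

section GaussInduction

lemma rat_gauss_induction {P : ℚ → Prop} (zero : P 0) (add_int : ∀ t (n : ℤ), P t → P (t + n))
    (inv : ∀ t, 0 < t → t < 1 → P t⁻¹ → P t) (s : ℚ) : P s := by
  induction hd : s.den using Nat.strong_induction_on generalizing s with
  | _ d ih =>
    rw [← Int.fract_add_floor s]
    refine add_int _ _ ?_
    have hden : (Int.fract s).den = d := hd ▸ Rat.sub_intCast_den s ⌊s⌋
    have hlt : (Int.fract s).num < (Int.fract s).den := Rat.num_lt_denom_iff.2 (Int.fract_lt_one s)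
    rcases (Int.fract_nonneg s).eq_or_lt with h0 | h0
    · rwa [← h0]
    · refine inv _ h0 (Int.fract_lt_one s) (ih _ ?_ _ rfl)
      have hnum : 0 < (Int.fract s).num := Rat.num_pos.2 h0
      rw [Rat.den_inv_of_ne_zero h0.ne', ← hden]
      omega

theorem dense_of_forall_add_int_mem_of_forall_inv_mem {S : Set ℝ} (hne : S.Nonempty)
    (hadd : ∀ x ∈ S, ∀ n : ℤ, x + n ∈ S) (hinv : ∀ x ∈ S, x⁻¹ ∈ S) : Dense S := by
  suffices hrat : ∀ s : ℚ, (s : ℝ) ∈ closure S from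
    dense_closure.1 (Rat.denseRange_cast.mono (Set.range_subset_iff.2 hrat))
  refine rat_gauss_induction ?_ (fun t n ht => ?_) fun t ht0 _ ht => ?_
  · obtain ⟨x, hx⟩ := hne
    have hlim : Tendsto (fun n : ℕ => (x + n)⁻¹) atTop (𝓝 0) :=
      (tendsto_atTop_add_const_left _ x tendsto_natCast_atTop_atTop).inv_tendsto_atTop
    rw [Rat.cast_zero]
    exact mem_closure_of_tendsto hlim (.of_forall fun n => hinv _ (mod_cast hadd x hx n))
  · push_cast
    exact map_mem_closure (f := fun x : ℝ => x + n) (by fun_prop) ht fun x hx => hadd x hx n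
  · have hne : ((t⁻¹ : ℚ) : ℝ) ≠ 0 := by exact_mod_cast (inv_pos.2 ht0).ne'
    have := (continuousAt_inv₀ hne).continuousWithinAt.mem_closure ht hinv
    rwa [Rat.cast_inv, inv_inv] at this

end GaussInduction

section GaussMap

/-- The product `y T(y) ⋯ T^{n-1}(y)` along an orbit of `T`. -/
def orbitProd {M : Type*} [CommMonoid M] (T : M → M) (n : ℕ) (y : M) : M :=
  ∏ i ∈ Finset.range n, T^[i] y

section

variable {M : Type*} [CommMonoid M] (T : M → M)

@[simp] lemma orbitProd_zero (y : M) : orbitProd T 0 y = 1 := Finset.prod_range_zero _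

lemma orbitProd_succ (n : ℕ) (y : M) : orbitProd T (n + 1) y = y * orbitProd T n (T y) := by
  simp only [orbitProd, Finset.prod_range_succ', Function.iterate_succ_apply, mul_comm,
    Function.iterate_zero, id]

lemma orbitProd_succ' (n : ℕ) (y : M) : orbitProd T (n + 1) y = orbitProd T n y * T^[n] y :=
  Finset.prod_range_succ _ n

@[simp] lemma orbitProd_one (y : M) : orbitProd T 1 y = y := Finset.prod_range_one _

end

lemma eq_neg_one_pow_mul_orbitProd_mul_iterate {R : Type*} [CommRing R] {T E : R → R} {S : Set R}
    (hT : Set.MapsTo T S S) (hE : ∀ y ∈ S, E y = -(y * E (T y))) {y : R} (hy : y ∈ S) (n : ℕ) :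
    E y = (-1) ^ n * orbitProd T n y * E (T^[n] y) := by
  induction n with
  | zero => simp
  | succ n ih =>
    rw [ih, hE _ (hT.iterate n hy), orbitProd_succ', Function.iterate_succ_apply', pow_succ]
    ring

lemma fract_mem_Ico (x : ℝ) : Int.fract x ∈ Set.Ico (0 : ℝ) 1 :=
  ⟨Int.fract_nonneg x, Int.fract_lt_one x⟩

lemma gaussMap_mem_Ico (y : ℝ) : gaussMap y ∈ Set.Ico (0 : ℝ) 1 := fract_mem_Ico _

lemma gaussMap_iterate_mem_Ico {y : ℝ} (hy : y ∈ Set.Ico (0 : ℝ) 1) (n : ℕ) :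
    gaussMap^[n] y ∈ Set.Ico (0 : ℝ) 1 :=
  Set.MapsTo.iterate (fun z _ => gaussMap_mem_Ico z) n hy

lemma exists_one_div_eq_gaussMap_add_natCast {y : ℝ} (hy : y ∈ Set.Ioo (0 : ℝ) 1) :
    ∃ n : ℕ, 1 ≤ n ∧ 1 / y = gaussMap y + n := by
  have hone : 1 ≤ 1 / y := (one_le_div hy.1).2 hy.2.le
  refine ⟨⌊1 / y⌋₊, Nat.one_le_floor_iff _ |>.2 hone, ?_⟩
  rw [natCast_floor_eq_intCast_floor (by linarith), gaussMap, Int.fract_add_floor]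

lemma mul_gaussMap_le_half {y : ℝ} (hy : y ∈ Set.Ico (0 : ℝ) 1) : y * gaussMap y ≤ 1 / 2 := by
  rcases hy.1.eq_or_lt with rfl | h0
  · norm_num
  obtain ⟨n, hn, heq⟩ := exists_one_div_eq_gaussMap_add_natCast ⟨h0, hy.2⟩
  have hn' : (1 : ℝ) ≤ n := by exact_mod_cast hn
  have hmul : y * gaussMap y + y * n = 1 := by rw [← mul_add, ← heq, mul_one_div_cancel h0.ne']
  nlinarith [(gaussMap_mem_Ico y).2]

lemma orbitProd_gaussMap_nonneg {y : ℝ} (hy : y ∈ Set.Ico (0 : ℝ) 1) (n : ℕ) :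
    0 ≤ orbitProd gaussMap n y :=
  Finset.prod_nonneg fun i _ => (gaussMap_iterate_mem_Ico hy i).1

lemma orbitProd_gaussMap_le {y : ℝ} (hy : y ∈ Set.Ico (0 : ℝ) 1) (n : ℕ) :
    orbitProd gaussMap n y ≤ 4 / 3 * (3 / 4) ^ n := by
  induction n using Nat.twoStepInduction generalizing y with
  | zero => norm_num
  | one => norm_num; exact hy.2.le
  | more n ih _ =>
    have hmem := gaussMap_mem_Ico (gaussMap y)
    have hnonneg := orbitProd_gaussMap_nonneg hmem n
    rw [orbitProd_succ, orbitProd_succ, ← mul_assoc]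
    calc y * gaussMap y * orbitProd gaussMap n (gaussMap (gaussMap y))
        ≤ 1 / 2 * (4 / 3 * (3 / 4) ^ n) := by
          gcongr
          exacts [mul_gaussMap_le_half hy, ih hmem]
      _ ≤ 4 / 3 * (3 / 4) ^ (n + 2) := by
          have : (0 : ℝ) < (3 / 4) ^ n := by positivity
          rw [pow_add]
          linarith

lemma tendsto_orbitProd_gaussMap {y : ℝ} (hy : y ∈ Set.Ico (0 : ℝ) 1) :
    Tendsto (fun n => orbitProd gaussMap n y) atTop (𝓝 0) := by
  have hgeom : Tendsto (fun n : ℕ => 4 / 3 * (3 / 4 : ℝ) ^ n) atTop (𝓝 0) := by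
    simpa using (tendsto_pow_atTop_nhds_zero_of_lt_one (r := (3 / 4 : ℝ)) (by norm_num)
      (by norm_num)).const_mul (4 / 3)
  exact squeeze_zero (orbitProd_gaussMap_nonneg hy) (orbitProd_gaussMap_le hy) hgeom

lemma irrational_fract {x : ℝ} (hx : Irrational x) : Irrational (Int.fract x) :=
  hx.sub_intCast _

lemma irrational_one_div {x : ℝ} (hx : Irrational x) : Irrational (1 / x) :=
  (one_div x).symm ▸ hx.inv

lemma irrational_gaussMap {x : ℝ} (hx : Irrational x) : Irrational (gaussMap x) :=
  irrational_fract (irrational_one_div hx)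

lemma irrational_gaussMap_iterate {x : ℝ} (hx : Irrational x) (n : ℕ) :
    Irrational (gaussMap^[n] x) :=
  Set.MapsTo.iterate (s := {y | Irrational y}) (fun _ => irrational_gaussMap) n hx

lemma fract_mem_Ioo {x : ℝ} (hx : Irrational x) : Int.fract x ∈ Set.Ioo (0 : ℝ) 1 :=
  ⟨(Int.fract_nonneg x).lt_of_ne' (irrational_fract hx).ne_zero, Int.fract_lt_one x⟩

lemma gaussMap_mem_Ioo {x : ℝ} (hx : Irrational x) : gaussMap x ∈ Set.Ioo (0 : ℝ) 1 :=
  fract_mem_Ioo (irrational_one_div hx)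

lemma orbitProd_gaussMap_ne_zero {x : ℝ} (hx : Irrational x) (n : ℕ) :
    orbitProd gaussMap n x ≠ 0 :=
  Finset.prod_ne_zero_iff.2 fun i _ => (irrational_gaussMap_iterate hx i).ne_zero

lemma continuousAt_fract_of_irrational {x : ℝ} (hx : Irrational x) :
    ContinuousAt (Int.fract : ℝ → ℝ) x :=
  continuousAt_fract (hx.ne_int _)

lemma continuousAt_gaussMap {x : ℝ} (hx : Irrational x) : ContinuousAt gaussMap x :=
  ContinuousAt.comp (f := fun y : ℝ => 1 / y)
    (continuousAt_fract_of_irrational (irrational_one_div hx))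
    (continuousAt_const.div continuousAt_id hx.ne_zero)

lemma continuousAt_gaussMap_iterate {x : ℝ} (hx : Irrational x) (n : ℕ) :
    ContinuousAt (gaussMap^[n]) x := by
  induction n with
  | zero => exact continuousAt_id
  | succ n ih =>
    rw [Function.iterate_succ']
    exact (continuousAt_gaussMap (irrational_gaussMap_iterate hx n)).comp ih

end GaussMap

section GaussSeries

/-- The `k`-th term `(-1)ᵏ y A(y) ⋯ A^{k-1}(y) H(A^k(y))`, with `y = {x}`, of `gaussSeries H x`. -/
noncomputable def gaussTerm (H : ℝ → ℝ) (k : ℕ) (x : ℝ) : ℝ :=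
  (-1) ^ k * orbitProd gaussMap k (Int.fract x) * H (gaussMap^[k] (Int.fract x))

/-- The bounded solution `F` of the functional equation `F(x) = H({x}) - {x} F(1/{x})`. -/
noncomputable def gaussSeries (H : ℝ → ℝ) (x : ℝ) : ℝ := ∑' k, gaussTerm H k x

variable {H : ℝ → ℝ} {M : ℝ}

lemma gaussSeries_periodic : Function.Periodic (gaussSeries H) 1 := fun x => by
  simp only [gaussSeries, gaussTerm, Int.fract_add_one]

lemma gaussSeries_fract (x : ℝ) : gaussSeries H (Int.fract x) = gaussSeries H x := by
  simp only [gaussSeries, gaussTerm, Int.fract_fract]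

lemma abs_gaussTerm_le (hM : ∀ y ∈ Set.Ico 0 1, |H y| ≤ M) (k : ℕ) (x : ℝ) :
    |gaussTerm H k x| ≤ 4 / 3 * M * (3 / 4) ^ k := by
  have hx := fract_mem_Ico x
  calc |gaussTerm H k x|
      = orbitProd gaussMap k (Int.fract x) * |H (gaussMap^[k] (Int.fract x))| := by
        rw [gaussTerm, abs_mul, abs_mul, abs_neg_one_pow, one_mul,
          abs_of_nonneg (orbitProd_gaussMap_nonneg hx k)]
    _ ≤ 4 / 3 * (3 / 4) ^ k * M := by
        gcongr
        exacts [orbitProd_gaussMap_le hx k, hM _ (gaussMap_iterate_mem_Ico hx k)]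
    _ = 4 / 3 * M * (3 / 4) ^ k := by ring

lemma hasSum_geometric_three_quarters (c : ℝ) :
    HasSum (fun k : ℕ => c * (3 / 4) ^ k) (c * 4) := by
  have := (hasSum_geometric_of_lt_one (r := (3 / 4 : ℝ)) (by norm_num) (by norm_num)).mul_left c
  norm_num at this
  exact this

lemma summable_gaussTerm (hM : ∀ y ∈ Set.Ico 0 1, |H y| ≤ M) (x : ℝ) :
    Summable fun k => gaussTerm H k x :=
  .of_norm_bounded (hasSum_geometric_three_quarters _).summable fun k => abs_gaussTerm_le hM k x

lemma abs_gaussSeries_le (hM : ∀ y ∈ Set.Ico 0 1, |H y| ≤ M) (x : ℝ) :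
    |gaussSeries H x| ≤ 4 / 3 * M * 4 := by
  rw [← Real.norm_eq_abs]
  exact tsum_of_norm_bounded (hasSum_geometric_three_quarters _) fun k => abs_gaussTerm_le hM k x

lemma gaussSeries_eq (hM : ∀ y ∈ Set.Ico 0 1, |H y| ≤ M) {x : ℝ} (hx : x ∈ Set.Ico 0 1) :
    gaussSeries H x = H x - x * gaussSeries H (1 / x) := by
  have hfract : Int.fract x = x := Int.fract_eq_self.2 hx
  have hterm : ∀ k, gaussTerm H (k + 1) x = -x * gaussTerm H k (1 / x) := fun k => by
    simp only [gaussTerm, hfract, orbitProd_succ, Function.iterate_succ_apply, gaussMap]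
    ring
  rw [gaussSeries, (summable_gaussTerm hM x).tsum_eq_zero_add]
  simp only [hterm, tsum_mul_left]
  rw [gaussSeries, neg_mul, ← sub_eq_add_neg]
  simp [gaussTerm, hfract]

lemma continuousAt_gaussTerm (hH : ContinuousOn H (Set.Ioo 0 1)) {x : ℝ} (hx : Irrational x)
    (k : ℕ) : ContinuousAt (gaussTerm H k) x := by
  have hx' : Irrational (Int.fract x) := irrational_fract hx
  have horbit : ∀ i, ContinuousAt (fun z => gaussMap^[i] (Int.fract z)) x := fun i =>
    ContinuousAt.comp (f := (Int.fract : ℝ → ℝ)) (continuousAt_gaussMap_iterate hx' i)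
      (continuousAt_fract_of_irrational hx)
  have hprod : ContinuousAt (fun z => orbitProd gaussMap k (Int.fract z)) x :=
    tendsto_finsetProd _ fun i _ => horbit i
  have hmem := gaussMap_iterate_mem_Ico (fract_mem_Ico x) k
  have hpos : 0 < gaussMap^[k] (Int.fract x) :=
    hmem.1.lt_of_ne' (irrational_gaussMap_iterate hx' k).ne_zero
  exact (continuousAt_const.mul hprod).mul
    (ContinuousAt.comp (f := fun z => gaussMap^[k] (Int.fract z))
      (hH.continuousAt (Ioo_mem_nhds hpos hmem.2)) (horbit k))

lemma continuousOn_gaussSeries (hH : ContinuousOn H (Set.Ioo 0 1))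
    (hM : ∀ y ∈ Set.Ico 0 1, |H y| ≤ M) : ContinuousOn (gaussSeries H) {x | Irrational x} :=
  continuousOn_tsum (fun k _ hx => (continuousAt_gaussTerm hH hx k).continuousWithinAt)
    (hasSum_geometric_three_quarters _).summable fun k x _ => abs_gaussTerm_le hM k x

section OneSidedLimits

lemma tendsto_one_div_nhdsLT {t : ℝ} (ht : 0 < t) :
    Tendsto (fun x : ℝ => 1 / x) (𝓝[<] t) (𝓝[>] (1 / t)) := by
  refine tendsto_nhdsWithin_iff.2 ⟨?_, ?_⟩
  · exact (continuousAt_const.div continuousAt_id ht.ne').tendsto.mono_left nhdsWithin_le_nhds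
  · filter_upwards [Ioo_mem_nhdsLT ht] with x hx
    exact one_div_lt_one_div_of_lt hx.1 hx.2

lemma tendsto_one_div_nhdsGT {t : ℝ} (ht : 0 < t) :
    Tendsto (fun x : ℝ => 1 / x) (𝓝[>] t) (𝓝[<] (1 / t)) := by
  refine tendsto_nhdsWithin_iff.2 ⟨?_, ?_⟩
  · exact (continuousAt_const.div continuousAt_id ht.ne').tendsto.mono_left nhdsWithin_le_nhds
  · filter_upwards [self_mem_nhdsWithin] with x hx
    exact one_div_lt_one_div_of_lt ht hx

variable {t l r : ℝ}

lemma tendsto_nhdsLT_add_intCast {f : ℝ → ℝ} (hf : Function.Periodic f 1)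
    (h : Tendsto f (𝓝[<] t) (𝓝 l)) (n : ℤ) : Tendsto f (𝓝[<] (t + n)) (𝓝 l) := by
  rw [← map_add_right_nhdsLT, tendsto_map'_iff]
  exact h.congr fun x => (by simpa using (hf.int_mul n x).symm)

lemma tendsto_nhdsGT_add_intCast {f : ℝ → ℝ} (hf : Function.Periodic f 1)
    (h : Tendsto f (𝓝[>] t) (𝓝 r)) (n : ℤ) : Tendsto f (𝓝[>] (t + n)) (𝓝 r) := by
  rw [← map_add_right_nhdsGT, tendsto_map'_iff]
  exact h.congr fun x => (by simpa using (hf.int_mul n x).symm)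

lemma exists_forall_mem_Ico_abs_le (hH : ContinuousOn H (Set.Icc 0 1)) :
    ∃ M, ∀ y ∈ Set.Ico 0 1, |H y| ≤ M := by
  obtain ⟨M, hM⟩ := isCompact_Icc.exists_bound_of_continuousOn hH
  exact ⟨M, fun y hy => hM y (Set.Ico_subset_Icc_self hy)⟩

lemma tendsto_gaussSeries_of_tendsto_one_div (hH : ContinuousOn H (Set.Icc 0 1))
    (ht : t ∈ Set.Icc 0 1) {u v : Filter ℝ} (hu : u ≤ 𝓝[Set.Ico 0 1] t)
    (hv : Tendsto (fun x => 1 / x) u v) (hl : Tendsto (gaussSeries H) v (𝓝 l)) :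
    Tendsto (gaussSeries H) u (𝓝 (H t - t * l)) := by
  obtain ⟨M, hM⟩ := exists_forall_mem_Ico_abs_le hH
  have hHt : Tendsto H u (𝓝 (H t)) :=
    (hH t ht).mono_left (hu.trans (nhdsWithin_mono t Set.Ico_subset_Icc_self))
  have hid : Tendsto (fun x => x) u (𝓝 t) := tendsto_id.mono_left (hu.trans nhdsWithin_le_nhds)
  refine (hHt.sub (hid.mul (hl.comp hv))).congr' ?_
  filter_upwards [hu self_mem_nhdsWithin] with x hx using (gaussSeries_eq hM hx).symm

lemma tendsto_gaussSeries_nhdsGT_zero (hH : ContinuousOn H (Set.Icc 0 1)) :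
    Tendsto (gaussSeries H) (𝓝[>] 0) (𝓝 (H 0)) := by
  obtain ⟨M, hM⟩ := exists_forall_mem_Ico_abs_le hH
  have hle : 𝓝[>] (0 : ℝ) ≤ 𝓝[Set.Ico 0 1] 0 := nhdsWithin_le_iff.2 (Ico_mem_nhdsGT one_pos)
  have hH0 : Tendsto H (𝓝[>] 0) (𝓝 (H 0)) :=
    (hH 0 (by simp)).mono_left (hle.trans (nhdsWithin_mono 0 Set.Ico_subset_Icc_self))
  have hmul : Tendsto (fun x : ℝ => x * gaussSeries H (1 / x)) (𝓝[>] 0) (𝓝 0) :=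
    bdd_le_mul_tendsto_zero' _ (.of_forall fun x => abs_gaussSeries_le hM (1 / x))
      (tendsto_id.mono_left nhdsWithin_le_nhds) |>.congr fun x => mul_comm _ _
  rw [← sub_zero (H 0)]
  refine (hH0.sub hmul).congr' ?_
  filter_upwards [hle self_mem_nhdsWithin] with x hx using (gaussSeries_eq hM hx).symm

lemma tendsto_gaussSeries_nhdsLT_zero (hH : ContinuousOn H (Set.Icc 0 1)) :
    Tendsto (gaussSeries H) (𝓝[<] 0) (𝓝 (H 1 - H 0)) := by
  have hright : Tendsto (gaussSeries H) (𝓝[>] (1 / 1)) (𝓝 (H 0)) := by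
    simpa using
      tendsto_nhdsGT_add_intCast gaussSeries_periodic (tendsto_gaussSeries_nhdsGT_zero hH) 1
  have hleft := tendsto_gaussSeries_of_tendsto_one_div hH (t := 1) (by simp)
    (nhdsWithin_le_iff.2 (Ico_mem_nhdsLT one_pos)) (tendsto_one_div_nhdsLT one_pos) hright
  simpa using tendsto_nhdsLT_add_intCast gaussSeries_periodic hleft (-1)

lemma den_inv_eq_mul_den {q : ℚ} (hq : 0 < q) : ((q⁻¹).den : ℝ) = q * q.den := by
  have hcast : ((q⁻¹).den : ℚ) = q * q.den := by
    rw [Rat.den_inv_of_ne_zero hq.ne', Rat.mul_den_eq_num, Nat.cast_natAbs,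
      abs_of_pos (Rat.num_pos.2 hq)]
  exact_mod_cast hcast

theorem exists_tendsto_gaussSeries_nhdsLT_nhdsGT (hH : ContinuousOn H (Set.Icc 0 1)) (q : ℚ) :
    ∃ l r, Tendsto (gaussSeries H) (𝓝[<] (q : ℝ)) (𝓝 l) ∧
      Tendsto (gaussSeries H) (𝓝[>] (q : ℝ)) (𝓝 r) ∧ r - l = (2 * H 0 - H 1) / q.den := by
  induction q using rat_gauss_induction with
  | zero =>
    refine ⟨H 1 - H 0, H 0, ?_, ?_, by simp; ring⟩
    · simpa using tendsto_gaussSeries_nhdsLT_zero hH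
    · simpa using tendsto_gaussSeries_nhdsGT_zero hH
  | add_int t n ih =>
    obtain ⟨l, r, hl, hr, hlr⟩ := ih
    rw [Rat.add_intCast_den]
    push_cast
    exact ⟨l, r, tendsto_nhdsLT_add_intCast gaussSeries_periodic hl n,
      tendsto_nhdsGT_add_intCast gaussSeries_periodic hr n, hlr⟩
  | inv t h0 h1 ih =>
    obtain ⟨l, r, hl, hr, hlr⟩ := ih
    have ht0 : (0 : ℝ) < t := by exact_mod_cast h0
    have ht1 : (t : ℝ) < 1 := by exact_mod_cast h1
    have hle : ∀ s : Set ℝ, 𝓝[s] (t : ℝ) ≤ 𝓝[Set.Ico 0 1] (t : ℝ) := fun s =>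
      nhdsWithin_le_iff.2 (mem_nhdsWithin_of_mem_nhds (Ico_mem_nhds ht0 ht1))
    rw [Rat.cast_inv, ← one_div] at hl hr
    refine ⟨_, _,
      tendsto_gaussSeries_of_tendsto_one_div hH ⟨ht0.le, ht1.le⟩ (hle _)
        (tendsto_one_div_nhdsLT ht0) hr,
      tendsto_gaussSeries_of_tendsto_one_div hH ⟨ht0.le, ht1.le⟩ (hle _)
        (tendsto_one_div_nhdsGT ht0) hl, ?_⟩
    rw [sub_sub_sub_cancel_left, ← mul_sub, hlr, den_inv_eq_mul_den h0]
    field_simp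

end OneSidedLimits

end GaussSeries

section DeltaKernel

open Real

/-- `u log u - log Γ(u)`, the antidifference of `u log (u / (u - 1))`: the by-excess orbit of
`-1 / u` contributes a difference of two of its values to `B₀(-1 / u)`. -/
noncomputable def gammaDefect (u : ℝ) : ℝ := u * log u - log (Gamma u)

/-- The continuous extension `-t log t + log Γ(1 + t)` of `log t - gammaDefect t` to `t = 0`. -/
noncomputable def fractDefect (t : ℝ) : ℝ := negMulLog t + log (Gamma (1 + t))

/-- The inhomogeneous term `H` of the functional equation `F(y) = H(y) - y F(1 / y)` of `Δ⁻` up to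
a continuous function. For `y ≠ 0` it is `y (g(1 / y) + φ({1 / y}))`, where `g` and `φ` are
`gammaDefect` and `fractDefect`; the summand `1 / y` is split off to get the value `1` at `0`. -/
noncomputable def deltaKernel (y : ℝ) : ℝ :=
  1 + y * (gammaDefect (1 / y) - 1 / y + fractDefect (Int.fract (1 / y)))

lemma continuousAt_log_Gamma {u : ℝ} (hu : 0 < u) : ContinuousAt (fun u => log (Gamma u)) u :=
  (differentiableAt_Gamma fun m => (by have := m.cast_nonneg (α := ℝ); linarith)).continuousAt.log
    (Gamma_pos_of_pos hu).ne'

lemma continuousAt_gammaDefect {u : ℝ} (hu : 0 < u) : ContinuousAt gammaDefect u :=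
  (continuousAt_id.mul (continuousAt_log hu.ne')).sub (continuousAt_log_Gamma hu)

lemma gammaDefect_sub_one {u : ℝ} (hu : 1 < u) :
    gammaDefect u = gammaDefect (u - 1) + u * (log u - log (u - 1)) := by
  have hGamma : Gamma u = (u - 1) * Gamma (u - 1) := by
    simpa using Gamma_add_one (s := u - 1) (by linarith)
  rw [gammaDefect, gammaDefect, hGamma,
    log_mul (by linarith) (Gamma_pos_of_pos (by linarith)).ne']
  ring

lemma abs_gammaDefect_sub_self_sub_le {u : ℝ} (hu : 1 < u) :
    |(gammaDefect u - u) - (gammaDefect (u - 1) - (u - 1))| ≤ log u - log (u - 1) := by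
  have hpos : 0 < u - 1 := by linarith
  have hpos' : 0 < u := by linarith
  have hlower : 1 - (u / (u - 1))⁻¹ ≤ log (u / (u - 1)) :=
    one_sub_inv_le_log_of_pos (by positivity)
  have hupper : log (u / (u - 1)) ≤ u / (u - 1) - 1 := log_le_sub_one_of_pos (by positivity)
  rw [gammaDefect_sub_one hu, ← log_div hpos'.ne' hpos.ne']
  set d := log (u / (u - 1))
  have hud : 1 ≤ u * d := by
    calc 1 = u * (1 - (u / (u - 1))⁻¹) := by field_simp; ring
      _ ≤ u * d := by gcongr
  have hud' : (u - 1) * d ≤ 1 := by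
    calc (u - 1) * d ≤ (u - 1) * (u / (u - 1) - 1) := by gcongr
      _ = 1 := by field_simp; ring
  rw [abs_le]
  constructor <;> linarith

lemma exists_abs_gammaDefect_sub_le :
    ∃ C, ∀ u : ℝ, 1 ≤ u → |gammaDefect u - u| ≤ C + log u := by
  have hcont : ContinuousOn (fun u => gammaDefect u - u) (Set.Icc 1 2) := fun u hu =>
    ((continuousAt_gammaDefect (by linarith [hu.1])).sub continuousAt_id).continuousWithinAt
  obtain ⟨C, hC⟩ := isCompact_Icc.exists_bound_of_continuousOn hcont
  have hC' : ∀ n : ℕ, ∀ u : ℝ, 1 ≤ u → u ≤ n + 2 → |gammaDefect u - u| ≤ C + log u := by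
    intro n
    induction n with
    | zero =>
      exact fun u h1 h2 => (hC u ⟨h1, by simpa using h2⟩).trans (by simpa using log_nonneg h1)
    | succ n ih =>
      intro u h1 hn
      rcases le_or_gt u 2 with h2 | h2
      · exact (hC u ⟨h1, h2⟩).trans (by simpa using log_nonneg h1)
      have hprev := ih (u - 1) (by linarith) (by push_cast at hn; linarith)
      have hstep := abs_gammaDefect_sub_self_sub_le (by linarith : 1 < u)
      linarith [abs_sub_abs_le_abs_sub (gammaDefect u - u) (gammaDefect (u - 1) - (u - 1))]
  exact ⟨C, fun u hu => hC' ⌈u⌉₊ u hu (by linarith [Nat.le_ceil u])⟩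

lemma fractDefect_zero : fractDefect 0 = 0 := by simp [fractDefect]

lemma fractDefect_one : fractDefect 1 = 0 := by
  simp [fractDefect, one_add_one_eq_two]

lemma fractDefect_eq {t : ℝ} (ht : 0 < t) : fractDefect t = log t - gammaDefect t := by
  rw [fractDefect, add_comm 1 t, Gamma_add_one ht.ne', log_mul ht.ne' (Gamma_pos_of_pos ht).ne',
    negMulLog, gammaDefect]
  ring

lemma continuousOn_fractDefect : ContinuousOn fractDefect (Set.Icc 0 1) := fun t ht =>
  (continuous_negMulLog.continuousAt.add
    (ContinuousAt.comp (f := fun t : ℝ => 1 + t) (continuousAt_log_Gamma (by linarith [ht.1]))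
      (by fun_prop))).continuousWithinAt

lemma continuous_fractDefect_fract : Continuous fun u : ℝ => fractDefect (Int.fract u) :=
  continuousOn_fractDefect.comp_fract'' (by rw [fractDefect_zero, fractDefect_one])

lemma deltaKernel_eq {y : ℝ} (hy : y ≠ 0) :
    deltaKernel y = y * (gammaDefect (1 / y) + fractDefect (Int.fract (1 / y))) := by
  rw [deltaKernel]
  field_simp
  ring

@[simp] lemma deltaKernel_zero : deltaKernel 0 = 1 := by simp [deltaKernel]

@[simp] lemma deltaKernel_one : deltaKernel 1 = 0 := by
  simp [deltaKernel, gammaDefect, fractDefect_zero]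

lemma exists_abs_deltaKernel_sub_one_le :
    ∃ C, ∀ y ∈ Set.Icc 0 1, |deltaKernel y - 1| ≤ C * y + negMulLog y := by
  obtain ⟨C, hC⟩ := exists_abs_gammaDefect_sub_le
  obtain ⟨K, hK⟩ := isCompact_Icc.exists_bound_of_continuousOn continuousOn_fractDefect
  refine ⟨C + K, fun y hy => ?_⟩
  rcases hy.1.eq_or_lt with rfl | h0
  · simp
  have hone : 1 ≤ 1 / y := (one_le_div h0).2 hy.2
  calc |deltaKernel y - 1|
      = y * |gammaDefect (1 / y) - 1 / y + fractDefect (Int.fract (1 / y))| := by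
        rw [deltaKernel, add_sub_cancel_left, abs_mul, abs_of_pos h0]
    _ ≤ y * (C + log (1 / y) + K) := by
        gcongr
        exact (abs_add_le _ _).trans
          (add_le_add (hC _ hone) (hK _ (Set.Ico_subset_Icc_self (fract_mem_Ico _))))
    _ = (C + K) * y + negMulLog y := by
        rw [one_div, log_inv, negMulLog]
        ring

lemma continuousWithinAt_deltaKernel_zero : ContinuousWithinAt deltaKernel (Set.Icc 0 1) 0 := by
  obtain ⟨C, hC⟩ := exists_abs_deltaKernel_sub_one_le
  have hbound : Continuous fun y : ℝ => C * y + negMulLog y :=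
    (continuous_const_mul C).add continuous_negMulLog
  have hlim : Tendsto (fun y : ℝ => C * y + negMulLog y) (𝓝[Set.Icc 0 1] 0) (𝓝 0) := by
    simpa using (hbound.tendsto 0).mono_left nhdsWithin_le_nhds
  rw [ContinuousWithinAt, deltaKernel_zero, tendsto_iff_norm_sub_tendsto_zero]
  exact squeeze_zero' (.of_forall fun _ => norm_nonneg _) (eventually_mem_nhdsWithin.mono hC) hlim

lemma continuousAt_deltaKernel {y : ℝ} (hy : 0 < y) : ContinuousAt deltaKernel y := by
  have hinv : ContinuousAt (fun y : ℝ => 1 / y) y := continuousAt_const.div continuousAt_id hy.ne'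
  have hgamma : ContinuousAt (fun y : ℝ => gammaDefect (1 / y)) y :=
    ContinuousAt.comp (f := fun y : ℝ => 1 / y)
      (continuousAt_gammaDefect (one_div_pos.2 hy)) hinv
  have hfract : ContinuousAt (fun y : ℝ => fractDefect (Int.fract (1 / y))) y :=
    ContinuousAt.comp (f := fun y : ℝ => 1 / y) continuous_fractDefect_fract.continuousAt hinv
  exact continuousAt_const.add (continuousAt_id.mul ((hgamma.sub hinv).add hfract))

lemma continuousOn_deltaKernel : ContinuousOn deltaKernel (Set.Icc 0 1) := fun _ hy =>
  hy.1.eq_or_lt.elim (fun h0 => h0 ▸ continuousWithinAt_deltaKernel_zero)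
    fun h0 => (continuousAt_deltaKernel h0).continuousWithinAt

end DeltaKernel

section ConditionalSum

open Finset

lemma hasSum_conditional_iff {M : Type*} [AddCommMonoid M] [TopologicalSpace M] {f : ℕ → M}
    {a : M} :
    HasSum f a (.conditional ℕ) ↔ Tendsto (fun n => ∑ i ∈ range n, f i) atTop (𝓝 a) := by
  rw [HasSum, SummationFilter.conditional_filter_eq_map_range, tendsto_map'_iff]
  rfl

lemma summable_conditional_of_summable {M : Type*} [AddCommMonoid M] [TopologicalSpace M]
    {f : ℕ → M} (hf : Summable f) : Summable f (.conditional ℕ) :=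
  hf.mono_filter (SummationFilter.conditional ℕ).le_atTop

lemma tendsto_zero_of_summable_conditional {M : Type*} [AddCommGroup M] [TopologicalSpace M]
    [IsTopologicalAddGroup M] {f : ℕ → M} (hf : Summable f (.conditional ℕ)) :
    Tendsto f atTop (𝓝 0) := by
  obtain ⟨a, ha⟩ := hf
  have hsum := hasSum_conditional_iff.1 ha
  rw [← sub_self a]
  refine (((tendsto_add_atTop_iff_nat 1).2 hsum).sub hsum).congr fun n => ?_
  rw [sum_range_succ, add_sub_cancel_left]

/-- The terms of the series `f` from index `N` on are `c` times those of the series `g`, and the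
terms before add up to `s`. Thus `∑ f = s + c * ∑ g`, also for conditionally convergent series. -/
structure HasTail {R : Type*} [Semiring R] (f : ℕ → R) (N : ℕ) (s c : R) (g : ℕ → R) : Prop where
  sum_range_eq : ∑ i ∈ range N, f i = s
  apply_add_eq : ∀ j, f (N + j) = c * g j

namespace HasTail

section Semiring

variable {R : Type*} [Semiring R] {f g h : ℕ → R} {M N : ℕ} {s t c d : R}

lemma refl (f : ℕ → R) : HasTail f 0 0 1 f := ⟨sum_range_zero f, fun j => by simp⟩

lemma trans (hfg : HasTail f N s c g) (hgh : HasTail g M t d h) :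
    HasTail f (N + M) (s + c * t) (c * d) h where
  sum_range_eq := by
    rw [sum_range_add, hfg.sum_range_eq, ← hgh.sum_range_eq, mul_sum]
    simp only [hfg.apply_add_eq]
  apply_add_eq j := by rw [add_assoc, hfg.apply_add_eq, hgh.apply_add_eq, mul_assoc]

lemma congr {s' c' : R} (hfg : HasTail f N s c g) (hs : s = s') (hc : c = c') :
    HasTail f N s' c' g := hs ▸ hc ▸ hfg

end Semiring

variable {𝕜 : Type*} [Field 𝕜] [TopologicalSpace 𝕜] [IsTopologicalRing 𝕜] {f g : ℕ → 𝕜} {N : ℕ}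
  {s c a : 𝕜}

lemma hasSum_iff (h : HasTail f N s c g) (hc : c ≠ 0) :
    HasSum f (s + c * a) (.conditional ℕ) ↔ HasSum g a (.conditional ℕ) := by
  have hsum : ∀ n, ∑ i ∈ range (n + N), f i = s + c * ∑ i ∈ range n, g i := fun n => by
    rw [add_comm n N, sum_range_add, h.sum_range_eq, mul_sum]
    simp only [h.apply_add_eq]
  rw [hasSum_conditional_iff, hasSum_conditional_iff,
    ← tendsto_add_atTop_iff_nat (f := fun n => ∑ i ∈ range n, f i) N]
  simp only [hsum]
  refine ⟨fun ht => ?_, fun ht => (ht.const_mul c).const_add s⟩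
  simpa [inv_mul_cancel_left₀ hc] using (ht.sub_const s).const_mul c⁻¹

lemma summable_iff (h : HasTail f N s c g) (hc : c ≠ 0) :
    Summable f (.conditional ℕ) ↔ Summable g (.conditional ℕ) := by
  refine ⟨fun ⟨a, ha⟩ => ⟨c⁻¹ * (a - s), (h.hasSum_iff hc).1 ?_⟩,
    fun ⟨_, ha⟩ => ⟨_, (h.hasSum_iff hc).2 ha⟩⟩
  rwa [mul_inv_cancel_left₀ hc, add_sub_cancel]

lemma tsum_eq [T2Space 𝕜] (h : HasTail f N s c g) (hc : c ≠ 0)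
    (hf : Summable f (.conditional ℕ)) :
    ∑'[.conditional ℕ] j, f j = s + c * ∑'[.conditional ℕ] j, g j :=
  ((h.hasSum_iff hc).2 ((h.summable_iff hc).1 hf).hasSum).tsum_eq

lemma tendsto_mul_tsum [T2Space 𝕜] {N : ℕ → ℕ} {s c : ℕ → 𝕜} {g : ℕ → ℕ → 𝕜}
    (h : ∀ m, HasTail f (N m) (s m) (c m) (g m)) (hc : ∀ m, c m ≠ 0)
    (hN : Tendsto N atTop atTop) (hf : Summable f (.conditional ℕ)) :
    Tendsto (fun m => c m * ∑'[.conditional ℕ] j, g m j) atTop (𝓝 0) := by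
  have hpartial := (hasSum_conditional_iff.1 hf.hasSum).comp hN
  rw [← sub_self (∑'[.conditional ℕ] j, f j)]
  refine (hpartial.const_sub _).congr fun m => ?_
  rw [Function.comp_apply, (h m).sum_range_eq, (h m).tsum_eq (hc m) hf, add_sub_cancel_left]

end HasTail

end ConditionalSum

section Wilton

open Real

lemma brjunoTerm_congr (T : ℝ → ℝ) {x y : ℝ} (h : Int.fract x = Int.fract y) :
    brjunoTerm T x = brjunoTerm T y := by
  ext j
  simp only [brjunoTerm, h]

lemma wiltonTerm_congr {x y : ℝ} (h : Int.fract x = Int.fract y) :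
    wiltonTerm x = wiltonTerm y := by
  ext j
  rw [wiltonTerm, wiltonTerm, brjunoTerm_congr gaussMap h]

lemma hasTail_brjunoTerm {T : ℝ → ℝ} {x x' : ℝ} (h : T (Int.fract x) = Int.fract x') :
    HasTail (brjunoTerm T x) 1 (-log (Int.fract x)) (Int.fract x) (brjunoTerm T x') where
  sum_range_eq := by simp [brjunoTerm]
  apply_add_eq j := by
    simp only [brjunoTerm, add_comm 1 j, Finset.prod_range_succ', Function.iterate_succ_apply, h,
      Function.iterate_zero, id]
    ring

lemma hasTail_wiltonTerm {x : ℝ} (hx : x ∈ Set.Ico 0 1) :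
    HasTail (wiltonTerm x) 1 (-log x) (-x) (wiltonTerm (gaussMap x)) := by
  have hfract : Int.fract x = x := Int.fract_eq_self.2 hx
  have htail := hasTail_brjunoTerm (T := gaussMap) (x := x) (x' := gaussMap x)
    (by rw [hfract, Int.fract_eq_self.2 (gaussMap_mem_Ico x)])
  rw [hfract] at htail
  refine ⟨by simpa [wiltonTerm] using htail.sum_range_eq, fun j => ?_⟩
  rw [wiltonTerm, wiltonTerm, htail.apply_add_eq, pow_add]
  ring

lemma exists_hasTail_wiltonTerm_iterate {x : ℝ} (hx : x ∈ Set.Ico 0 1) (n : ℕ) :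
    ∃ s, HasTail (wiltonTerm x) n s ((-1) ^ n * orbitProd gaussMap n x)
      (wiltonTerm (gaussMap^[n] x)) := by
  induction n with
  | zero => exact ⟨0, (HasTail.refl _).congr rfl (by simp)⟩
  | succ n ih =>
    obtain ⟨s, hs⟩ := ih
    have hstep := hs.trans (hasTail_wiltonTerm (gaussMap_iterate_mem_Ico hx n))
    rw [← Function.iterate_succ_apply' gaussMap n x] at hstep
    exact ⟨_, hstep.congr rfl (by rw [orbitProd_succ', pow_succ]; ring)⟩

lemma wiltonConverges_gaussMap_iff {x : ℝ} (hx : x ∈ Set.Ioo 0 1) :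
    WiltonConverges (gaussMap x) ↔ WiltonConverges x :=
  ((hasTail_wiltonTerm (Set.Ioo_subset_Ico_self hx)).summable_iff (neg_ne_zero.2 hx.1.ne')).symm

lemma wilton_eq {x : ℝ} (hx : x ∈ Set.Ioo 0 1) (h : WiltonConverges x) :
    wilton x = -log x - x * wilton (gaussMap x) := by
  rw [wilton, (hasTail_wiltonTerm (Set.Ioo_subset_Ico_self hx)).tsum_eq (neg_ne_zero.2 hx.1.ne') h,
    wilton, neg_mul, sub_eq_add_neg]

lemma tendsto_orbitProd_mul_wilton {x : ℝ} (hx : Irrational x) (hx01 : x ∈ Set.Ico 0 1)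
    (h : WiltonConverges x) :
    Tendsto (fun m => orbitProd gaussMap (2 * m) x * wilton (gaussMap^[2 * m] x)) atTop (𝓝 0) := by
  choose s hs using fun m => exists_hasTail_wiltonTerm_iterate hx01 (2 * m)
  simp only [even_two_mul, Even.neg_one_pow, one_mul] at hs
  exact HasTail.tendsto_mul_tsum hs (fun m => orbitProd_gaussMap_ne_zero hx (2 * m))
    (tendsto_id.const_mul_atTop' two_pos) h

/-- The value `-t log t - (2 - t) log (1 - t)` of `W(x) + W(-x)` at an irrational `x` whose distance
to the nearest integer is `t`. -/
noncomputable def wiltonEven (t : ℝ) : ℝ := negMulLog t - (2 - t) * log (1 - t)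

lemma hasTail_wiltonTerm_one_sub {y : ℝ} (hy : y ∈ Set.Ioo 0 (1 / 2)) :
    HasTail (wiltonTerm (1 - y)) 2 (wiltonEven y + log y) y (wiltonTerm (gaussMap y)) := by
  obtain ⟨h0, h1⟩ := hy
  have hpos : 0 < 1 - y := by linarith
  have hquot : y / (1 - y) ∈ Set.Ico 0 1 :=
    ⟨by positivity, (div_lt_one hpos).2 (by linarith)⟩
  have hfirst := hasTail_wiltonTerm (x := 1 - y) ⟨hpos.le, by linarith⟩
  have hmid : wiltonTerm (gaussMap (1 - y)) = wiltonTerm (y / (1 - y)) :=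
    wiltonTerm_congr ((Int.fract_fract _).trans
      (Int.fract_eq_fract.2 ⟨1, by field_simp; push_cast; ring⟩))
  have hlast : gaussMap (y / (1 - y)) = gaussMap y :=
    Int.fract_eq_fract.2 ⟨-1, by field_simp; push_cast; ring⟩
  rw [hmid] at hfirst
  have htail := hfirst.trans (hasTail_wiltonTerm hquot)
  rw [hlast] at htail
  refine htail.congr ?_ (by field_simp)
  rw [log_div h0.ne' hpos.ne', wiltonEven, negMulLog]
  ring

lemma hasSum_wiltonTerm_one_sub_iff {y a : ℝ} (hy : y ∈ Set.Ioo 0 (1 / 2)) :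
    HasSum (wiltonTerm (1 - y)) (wiltonEven y - a) (.conditional ℕ) ↔
      HasSum (wiltonTerm y) a (.conditional ℕ) := by
  have h0 : y ≠ 0 := hy.1.ne'
  obtain ⟨b, rfl⟩ : ∃ b, a = -log y + -y * b := ⟨-(a + log y) / y, by field_simp; ring⟩
  rw [(hasTail_wiltonTerm ⟨hy.1.le, by linarith [hy.2]⟩).hasSum_iff (neg_ne_zero.2 h0),
    ← (hasTail_wiltonTerm_one_sub hy).hasSum_iff h0]
  ring_nf

lemma hasSum_wiltonTerm_neg_iff {x a : ℝ} (hx : Irrational x) :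
    HasSum (wiltonTerm (-x)) (wiltonEven ‖(x : UnitAddCircle)‖ - a) (.conditional ℕ) ↔
      HasSum (wiltonTerm x) a (.conditional ℕ) := by
  obtain ⟨h0, h1⟩ := fract_mem_Ioo hx
  have hne : Int.fract x ≠ 1 / 2 := by
    simpa using (irrational_fract hx).ne_rat (1 / 2)
  have hterm : wiltonTerm (Int.fract x) = wiltonTerm x := wiltonTerm_congr (Int.fract_fract x)
  have hterm' : wiltonTerm (1 - Int.fract x) = wiltonTerm (-x) :=
    wiltonTerm_congr (Int.fract_eq_fract.2 ⟨⌊x⌋ + 1, by rw [Int.fract]; push_cast; ring⟩)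
  rw [UnitAddCircle.norm_eq, abs_sub_round_eq_min]
  rcases hne.lt_or_gt with h | h
  · have hiff := hasSum_wiltonTerm_one_sub_iff (a := a) ⟨h0, h⟩
    rwa [hterm, hterm', ← min_eq_left (by linarith : Int.fract x ≤ 1 - Int.fract x)] at hiff
  · have hmin := min_eq_right (by linarith : 1 - Int.fract x ≤ Int.fract x)
    have hiff := hasSum_wiltonTerm_one_sub_iff (a := wiltonEven (1 - Int.fract x) - a)
      (y := 1 - Int.fract x) ⟨by linarith, by linarith⟩
    rwa [sub_sub_cancel, sub_sub_cancel, hterm, hterm', ← hmin, iff_comm] at hiff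

lemma wiltonConverges_neg_iff {x : ℝ} (hx : Irrational x) :
    WiltonConverges (-x) ↔ WiltonConverges x :=
  ⟨fun ⟨_, ha⟩ => ⟨_, (hasSum_wiltonTerm_neg_iff hx).1 (by rwa [sub_sub_cancel])⟩,
    fun ⟨_, ha⟩ => ⟨_, (hasSum_wiltonTerm_neg_iff hx).2 ha⟩⟩

lemma wilton_neg {x : ℝ} (hx : Irrational x) (h : WiltonConverges x) :
    wilton (-x) = wiltonEven ‖(x : UnitAddCircle)‖ - wilton x :=
  ((hasSum_wiltonTerm_neg_iff hx).2 h.hasSum).tsum_eq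

lemma norm_unitAddCircle_mem_Icc (x : UnitAddCircle) : ‖x‖ ∈ Set.Icc 0 (1 / 2) := by
  simpa using And.intro (norm_nonneg x) (AddCircle.norm_le_half_period 1 one_ne_zero)

lemma continuousOn_wiltonEven : ContinuousOn wiltonEven (Set.Icc 0 (1 / 2)) := by
  refine continuous_negMulLog.continuousOn.sub
    ((continuous_sub_left 2).continuousOn.mul ((continuous_sub_left 1).continuousOn.log ?_))
  exact fun t ht => by linarith [ht.2]

lemma continuous_wiltonEven_norm : Continuous fun x : ℝ => wiltonEven ‖(x : UnitAddCircle)‖ :=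
  continuousOn_wiltonEven.comp_continuous (continuous_norm.comp (AddCircle.continuous_mk' 1))
    fun x => norm_unitAddCircle_mem_Icc x

lemma exists_abs_wiltonEven_norm_le : ∃ C, ∀ x : UnitAddCircle, |wiltonEven ‖x‖| ≤ C := by
  obtain ⟨C, hC⟩ := isCompact_Icc.exists_bound_of_continuousOn continuousOn_wiltonEven
  exact ⟨C, fun x => hC _ (norm_unitAddCircle_mem_Icc x)⟩

end Wilton

section SemiBrjuno

open Real

variable {x : ℝ}

lemma byExcessMap_eq (hx : Irrational x) : byExcessMap x = Int.fract (-(1 / x)) := by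
  rw [Int.fract_neg (irrational_gaussMap hx).ne_zero, byExcessMap, Int.floor_add_one, Int.fract]
  push_cast
  ring

lemma fract_neg_fract (x : ℝ) : Int.fract (-Int.fract x) = Int.fract (-x) :=
  Int.fract_eq_fract.2 ⟨⌊x⌋, by rw [Int.fract]; ring⟩

lemma hasTail_brjunoTerm_neg_gaussMap (hx : Irrational x) (hx01 : x ∈ Set.Ioo 0 1) :
    HasTail (brjunoTerm byExcessMap x) 1 (-log x) x (brjunoTerm byExcessMap (-gaussMap x)) := by
  have hfract : Int.fract x = x := Int.fract_eq_self.2 (Set.Ioo_subset_Ico_self hx01)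
  have htail := hasTail_brjunoTerm (T := byExcessMap) (x := x) (x' := -gaussMap x)
    (by rw [hfract, byExcessMap_eq hx, gaussMap, fract_neg_fract])
  rwa [hfract] at htail

lemma hasTail_brjunoTerm_neg_one_div_sub_one {u : ℝ} (hu : Irrational u) (h1 : 1 < u) :
    HasTail (brjunoTerm byExcessMap (-(1 / u))) 1 (log u - log (u - 1)) ((u - 1) / u)
      (brjunoTerm byExcessMap (-(1 / (u - 1)))) := by
  have hpos : 0 < u - 1 := by linarith
  have hpos' : 0 < u := by linarith
  have hfract : Int.fract (-(1 / u)) = (u - 1) / u :=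
    Int.fract_eq_iff.2 ⟨by positivity, (div_lt_one hpos').2 (by linarith), -1,
      by field_simp; push_cast; ring⟩
  have htail := hasTail_brjunoTerm (T := byExcessMap) (x := -(1 / u)) (x' := -(1 / (u - 1))) (by
    rw [byExcessMap_eq (irrational_fract (irrational_one_div hu).neg), hfract]
    exact Int.fract_eq_fract.2 ⟨-1, by field_simp; push_cast; ring⟩)
  rw [hfract] at htail
  exact htail.congr (by rw [log_div hpos.ne' hpos'.ne', neg_sub]) rfl

lemma hasTail_brjunoTerm_neg_one_div_add_natCast {v : ℝ} (hv : Irrational v) (h0 : 0 < v)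
    (n : ℕ) :
    HasTail (brjunoTerm byExcessMap (-(1 / (v + n)))) n
      ((gammaDefect (v + n) - gammaDefect v) / (v + n)) (v / (v + n))
      (brjunoTerm byExcessMap (-(1 / v))) := by
  induction n with
  | zero => simpa [h0.ne'] using HasTail.refl (brjunoTerm byExcessMap (-(1 / v)))
  | succ n ih =>
    have hn : 0 < v + n := by positivity
    have hsub : v + (n + 1 : ℕ) - 1 = v + n := by push_cast; ring
    have hone : 1 < v + (n + 1 : ℕ) := by linarith only [hn, hsub]
    have hstep := hasTail_brjunoTerm_neg_one_div_sub_one (hv.add_natCast (n + 1)) hone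
    rw [hsub] at hstep
    have htail := hstep.trans ih
    rw [add_comm 1 n] at htail
    refine htail.congr ?_ (by field_simp)
    rw [gammaDefect_sub_one hone, hsub]
    field_simp
    ring

lemma exists_hasTail_brjunoTerm_neg (hx : Irrational x) (hx01 : x ∈ Set.Ioo 0 1) :
    ∃ n, 1 ≤ n ∧ HasTail (brjunoTerm byExcessMap (-x)) n
      (x * (gammaDefect (1 / x) - gammaDefect (gaussMap x))) (x * gaussMap x)
      (brjunoTerm byExcessMap (-gaussMap (gaussMap x))) := by
  obtain ⟨n, hn, hx_eq⟩ := exists_one_div_eq_gaussMap_add_natCast hx01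
  have htail := hasTail_brjunoTerm_neg_one_div_add_natCast (irrational_gaussMap hx)
    (gaussMap_mem_Ioo hx).1 n
  have hterm : brjunoTerm byExcessMap (-(1 / gaussMap x)) =
      brjunoTerm byExcessMap (-gaussMap (gaussMap x)) :=
    brjunoTerm_congr byExcessMap (fract_neg_fract (1 / gaussMap x)).symm
  rw [← hx_eq, one_div_one_div, hterm] at htail
  exact ⟨n, hn, htail.congr (by rw [div_div_eq_mul_div, div_one, mul_comm])
    (by rw [div_div_eq_mul_div, div_one, mul_comm])⟩

lemma exists_hasTail_brjunoTerm_neg_iterate (hx : Irrational x) (hx01 : x ∈ Set.Ioo 0 1) (m : ℕ) :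
    ∃ N s, m ≤ N ∧ HasTail (brjunoTerm byExcessMap (-x)) N s (orbitProd gaussMap (2 * m) x)
      (brjunoTerm byExcessMap (-gaussMap^[2 * m] x)) := by
  induction m with
  | zero => exact ⟨0, 0, le_rfl, (HasTail.refl _).congr rfl (by simp)⟩
  | succ m ih =>
    obtain ⟨N, s, hN, hs⟩ := ih
    have hirr := irrational_gaussMap_iterate hx (2 * m)
    obtain ⟨n, hn, hstep⟩ := exists_hasTail_brjunoTerm_neg hirr
      ⟨(gaussMap_iterate_mem_Ico (Set.Ioo_subset_Ico_self hx01) _).1.lt_of_ne' hirr.ne_zero,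
        (gaussMap_iterate_mem_Ico (Set.Ioo_subset_Ico_self hx01) _).2⟩
    rw [← Function.iterate_succ_apply' gaussMap, ← Function.iterate_succ_apply' gaussMap] at hstep
    refine ⟨N + n, _, by omega, (hs.trans hstep).congr rfl ?_⟩
    rw [show 2 * (m + 1) = 2 * m + 1 + 1 by ring, orbitProd_succ', orbitProd_succ', mul_assoc]

lemma semiBrjunoConverges_neg_gaussMap_iff (hx : Irrational x) (hx01 : x ∈ Set.Ioo 0 1) :
    SemiBrjunoConverges (-gaussMap x) ↔ SemiBrjunoConverges x :=
  ((hasTail_brjunoTerm_neg_gaussMap hx hx01).summable_iff hx01.1.ne').symm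

lemma semiBrjunoConverges_gaussMap_iff (hx : Irrational x) (hx01 : x ∈ Set.Ioo 0 1) :
    SemiBrjunoConverges (gaussMap x) ↔ SemiBrjunoConverges (-x) := by
  have hA := gaussMap_mem_Ioo hx
  obtain ⟨n, -, htail⟩ := exists_hasTail_brjunoTerm_neg hx hx01
  rw [SemiBrjunoConverges, SemiBrjunoConverges, htail.summable_iff (mul_pos hx01.1 hA.1).ne',
    (hasTail_brjunoTerm_neg_gaussMap (irrational_gaussMap hx) hA).summable_iff hA.1.ne']

lemma semiBrjuno_eq (hx : Irrational x) (hx01 : x ∈ Set.Ioo 0 1) (h : SemiBrjunoConverges x) :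
    semiBrjuno x = -log x + x * semiBrjuno (-gaussMap x) :=
  (hasTail_brjunoTerm_neg_gaussMap hx hx01).tsum_eq hx01.1.ne' h

lemma semiBrjuno_neg (hx : Irrational x) (hx01 : x ∈ Set.Ioo 0 1)
    (h : SemiBrjunoConverges (-x)) :
    semiBrjuno (-x) = deltaKernel x + x * semiBrjuno (gaussMap x) := by
  have hA := gaussMap_mem_Ioo hx
  obtain ⟨n, -, htail⟩ := exists_hasTail_brjunoTerm_neg hx hx01
  have hneg : semiBrjuno (-x) = x * (gammaDefect (1 / x) - gammaDefect (gaussMap x)) +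
      x * gaussMap x * semiBrjuno (-gaussMap (gaussMap x)) :=
    htail.tsum_eq (mul_pos hx01.1 hA.1).ne' h
  rw [hneg, semiBrjuno_eq (irrational_gaussMap hx) hA
    ((semiBrjunoConverges_gaussMap_iff hx hx01).2 h), deltaKernel_eq hx01.1.ne', ← gaussMap,
    fractDefect_eq hA.1]
  ring

lemma tendsto_orbitProd_mul_semiBrjuno_neg (hx : Irrational x) (hx01 : x ∈ Set.Ioo 0 1)
    (h : SemiBrjunoConverges (-x)) :
    Tendsto (fun m => orbitProd gaussMap (2 * m) x * semiBrjuno (-gaussMap^[2 * m] x)) atTop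
      (𝓝 0) := by
  choose N s hN hs using exists_hasTail_brjunoTerm_neg_iterate hx hx01
  exact HasTail.tendsto_mul_tsum hs (fun m => orbitProd_gaussMap_ne_zero hx (2 * m))
    (tendsto_atTop_mono hN tendsto_id) h

end SemiBrjuno

section Domain

open Real

variable {x y : ℝ}

lemma mem_deltaMinusDomain_iff :
    x ∈ deltaMinusDomain ↔
      Irrational x ∧ WiltonConverges x ∧ SemiBrjunoConverges x ∧ SemiBrjunoConverges (-x) :=
  and_congr_right fun hx => by rw [wiltonConverges_neg_iff hx, and_self_left]

lemma neg_mem_deltaMinusDomain (h : x ∈ deltaMinusDomain) : -x ∈ deltaMinusDomain := by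
  obtain ⟨hx, hw, hw', hb, hb'⟩ := h
  exact ⟨hx.neg, hw', by rwa [neg_neg], hb', by rwa [neg_neg]⟩

lemma add_intCast_mem_deltaMinusDomain_iff (n : ℤ) :
    x + n ∈ deltaMinusDomain ↔ x ∈ deltaMinusDomain := by
  have hfract := Int.fract_add_intCast x n
  have hfract_neg : Int.fract (-(x + n)) = Int.fract (-x) := by
    rw [neg_add, ← Int.cast_neg, Int.fract_add_intCast]
  simp only [mem_deltaMinusDomain_iff, irrational_add_intCast_iff, WiltonConverges,
    SemiBrjunoConverges, wiltonTerm_congr hfract, brjunoTerm_congr _ hfract,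
    brjunoTerm_congr _ hfract_neg]

lemma fract_mem_deltaMinusDomain_iff : Int.fract x ∈ deltaMinusDomain ↔ x ∈ deltaMinusDomain := by
  rw [← add_intCast_mem_deltaMinusDomain_iff ⌊x⌋, Int.fract_add_floor]

lemma gaussMap_mem_deltaMinusDomain_iff (hx : Irrational x) (hx01 : x ∈ Set.Ioo 0 1) :
    gaussMap x ∈ deltaMinusDomain ↔ x ∈ deltaMinusDomain := by
  simp only [mem_deltaMinusDomain_iff, hx, irrational_gaussMap hx, true_and,
    wiltonConverges_gaussMap_iff hx01, semiBrjunoConverges_gaussMap_iff hx hx01,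
    semiBrjunoConverges_neg_gaussMap_iff hx hx01, and_comm (a := SemiBrjunoConverges (-x))]

lemma inv_mem_deltaMinusDomain (h : x ∈ deltaMinusDomain) : x⁻¹ ∈ deltaMinusDomain := by
  wlog hpos : 0 < x generalizing x
  · have hneg : 0 < -x := neg_pos.2 ((not_lt.1 hpos).lt_of_ne h.1.ne_zero)
    simpa only [inv_neg, neg_neg] using
      neg_mem_deltaMinusDomain (this (neg_mem_deltaMinusDomain h) hneg)
  rcases h.1.ne_one.lt_or_gt with hlt | hgt
  · rw [← one_div, ← fract_mem_deltaMinusDomain_iff]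
    exact (gaussMap_mem_deltaMinusDomain_iff h.1 ⟨hpos, hlt⟩).2 h
  · refine (gaussMap_mem_deltaMinusDomain_iff h.1.inv ⟨inv_pos.2 hpos, inv_lt_one_of_one_lt₀ hgt⟩).1
      ?_
    rwa [gaussMap, one_div, inv_inv, fract_mem_deltaMinusDomain_iff]

lemma brjunoTerm_of_isFixedPt {T : ℝ → ℝ} (hT : Function.IsFixedPt T (Int.fract x)) (j : ℕ) :
    brjunoTerm T x j = Int.fract x ^ j * log (1 / Int.fract x) := by
  simp only [brjunoTerm, (hT.iterate _).eq, Finset.prod_const, Finset.card_range]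

lemma summable_brjunoTerm_of_isFixedPt {T : ℝ → ℝ} (hT : Function.IsFixedPt T (Int.fract x)) :
    Summable (brjunoTerm T x) := by
  rw [funext (brjunoTerm_of_isFixedPt hT)]
  exact (summable_geometric_of_lt_one (Int.fract_nonneg x) (Int.fract_lt_one x)).mul_right _

lemma wiltonConverges_of_isFixedPt (hx : Function.IsFixedPt gaussMap (Int.fract x)) :
    WiltonConverges x := by
  refine summable_conditional_of_summable (.of_norm ?_)
  simpa [wiltonTerm] using (summable_brjunoTerm_of_isFixedPt hx).norm

lemma goldenRatio_mem_deltaMinusDomain : goldenRatio ∈ deltaMinusDomain := by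
  have hirr := goldenRatio_irrational
  have hgt := one_lt_goldenRatio
  have hlt := goldenRatio_lt_two
  have hinv : 1 / (goldenRatio - 1) = goldenRatio := by
    rw [div_eq_iff (by linarith)]
    linarith [goldenRatio_sq, sq goldenRatio]
  have hinv' : 1 / (2 - goldenRatio) = goldenRatio + 1 := by
    rw [div_eq_iff (by linarith)]
    linarith [goldenRatio_sq, sq goldenRatio]
  have hfract : Int.fract goldenRatio = goldenRatio - 1 :=
    Int.fract_eq_iff.2 ⟨by linarith, by linarith, 1, by simp⟩
  have hfract_neg : Int.fract (-goldenRatio) = 2 - goldenRatio :=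
    Int.fract_eq_iff.2 ⟨by linarith, by linarith, -2, by push_cast; ring⟩
  have hwilton : WiltonConverges goldenRatio :=
    wiltonConverges_of_isFixedPt (by rw [hfract, Function.IsFixedPt, gaussMap, hinv, hfract])
  have hneg : SemiBrjunoConverges (-goldenRatio) := by
    refine summable_conditional_of_summable (summable_brjunoTerm_of_isFixedPt ?_)
    rw [Function.IsFixedPt, byExcessMap_eq (irrational_fract hirr.neg), hfract_neg, hinv',
      ← hfract_neg]
    exact Int.fract_eq_fract.2 ⟨-1, by push_cast; ring⟩
  refine mem_deltaMinusDomain_iff.2 ⟨hirr, hwilton, ?_, hneg⟩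
  refine ((hasTail_brjunoTerm (x' := -goldenRatio) ?_).summable_iff
    (irrational_fract hirr).ne_zero).2 hneg
  rw [byExcessMap_eq (irrational_fract hirr), hfract, hinv]

theorem dense_deltaMinusDomain : Dense deltaMinusDomain :=
  dense_of_forall_add_int_mem_of_forall_inv_mem ⟨_, goldenRatio_mem_deltaMinusDomain⟩
    (fun _ hx n => (add_intCast_mem_deltaMinusDomain_iff n).2 hx)
    fun _ => inv_mem_deltaMinusDomain

end Domain

section Extension

variable {x : ℝ}

/-- The function `W(x) - B₀(x) + B₀(-x)`, which differs from `Δ⁻(x)` by the even part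
`(W(x) + W(-x)) / 2` only, and satisfies an exact functional equation under the Gauss map. -/
noncomputable def wiltonSubSemiBrjuno (x : ℝ) : ℝ := wilton x - semiBrjuno x + semiBrjuno (-x)

lemma wiltonSubSemiBrjuno_fract (x : ℝ) :
    wiltonSubSemiBrjuno (Int.fract x) = wiltonSubSemiBrjuno x := by
  have hfract := Int.fract_fract x
  simp only [wiltonSubSemiBrjuno, wilton, semiBrjuno, wiltonTerm_congr hfract,
    brjunoTerm_congr _ hfract, brjunoTerm_congr _ (fract_neg_fract x)]

lemma wiltonSubSemiBrjuno_eq (hx : x ∈ deltaMinusDomain) (hx01 : x ∈ Set.Ioo 0 1) :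
    wiltonSubSemiBrjuno x = deltaKernel x - x * wiltonSubSemiBrjuno (gaussMap x) := by
  obtain ⟨hirr, hw, -, hb, hb'⟩ := hx
  rw [wiltonSubSemiBrjuno, wilton_eq hx01 hw, semiBrjuno_eq hirr hx01 hb,
    semiBrjuno_neg hirr hx01 hb', wiltonSubSemiBrjuno]
  ring

lemma mapsTo_gaussMap_deltaMinusDomain :
    Set.MapsTo gaussMap (deltaMinusDomain ∩ Set.Ioo 0 1) (deltaMinusDomain ∩ Set.Ioo 0 1) :=
  fun _ hx => ⟨(gaussMap_mem_deltaMinusDomain_iff hx.1.1 hx.2).2 hx.1, gaussMap_mem_Ioo hx.1.1⟩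

lemma tendsto_orbitProd_mul_semiBrjuno (hx : x ∈ deltaMinusDomain ∩ Set.Ioo 0 1) :
    Tendsto (fun m => orbitProd gaussMap (2 * m) x * semiBrjuno (gaussMap^[2 * m] x)) atTop
      (𝓝 0) := by
  have hA := mapsTo_gaussMap_deltaMinusDomain hx
  have hfract : Int.fract x = x := Int.fract_eq_self.2 (Set.Ioo_subset_Ico_self hx.2)
  have hterm : Tendsto (fun m => wiltonTerm x (2 * m)) atTop (𝓝 0) :=
    (tendsto_zero_of_summable_conditional hx.1.2.1).comp (tendsto_id.const_mul_atTop' two_pos)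
  have htail := (tendsto_orbitProd_mul_semiBrjuno_neg hA.1.1 hA.2 hA.1.2.2.2.2).const_mul x
  have hlim := hterm.add htail
  rw [mul_zero, add_zero] at hlim
  refine hlim.congr fun m => ?_
  have hm := mapsTo_gaussMap_deltaMinusDomain.iterate (2 * m) hx
  have hlog : wiltonTerm x (2 * m) =
      orbitProd gaussMap (2 * m) x * -Real.log (gaussMap^[2 * m] x) := by
    simp [wiltonTerm, brjunoTerm, hfract, orbitProd]
  rw [semiBrjuno_eq hm.1.1 hm.2 hm.1.2.2.2.1, mul_add, ← hlog, ← mul_assoc, ← mul_assoc,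
    ← orbitProd_succ, ← orbitProd_succ', ← Function.iterate_succ_apply' gaussMap,
    Function.iterate_succ_apply]

lemma tendsto_orbitProd_mul_of_abs_le {F : ℝ → ℝ} {B : ℝ} (hF : ∀ y, |F y| ≤ B)
    (hx : x ∈ Set.Ico 0 1) :
    Tendsto (fun n => orbitProd gaussMap n x * F (gaussMap^[n] x)) atTop (𝓝 0) :=
  (tendsto_orbitProd_gaussMap hx).zero_mul_isBoundedUnder_le
    ⟨B, eventually_map.2 (.of_forall fun n => hF (gaussMap^[n] x))⟩

lemma exists_abs_gaussSeries_deltaKernel_le : ∃ B, ∀ x, |gaussSeries deltaKernel x| ≤ B :=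
  let ⟨_, hM⟩ := exists_forall_mem_Ico_abs_le continuousOn_deltaKernel
  ⟨_, abs_gaussSeries_le hM⟩

lemma wiltonSubSemiBrjuno_sub_gaussSeries_eq (hx : x ∈ deltaMinusDomain ∩ Set.Ioo 0 1) :
    wiltonSubSemiBrjuno x - gaussSeries deltaKernel x =
      -(x * (wiltonSubSemiBrjuno (gaussMap x) - gaussSeries deltaKernel (gaussMap x))) := by
  obtain ⟨M, hM⟩ := exists_forall_mem_Ico_abs_le continuousOn_deltaKernel
  rw [wiltonSubSemiBrjuno_eq hx.1 hx.2, gaussSeries_eq hM (Set.Ioo_subset_Ico_self hx.2), gaussMap,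
    gaussSeries_fract]
  ring

lemma wiltonSubSemiBrjuno_eq_gaussSeries_of_mem_Ioo (hx : x ∈ deltaMinusDomain ∩ Set.Ioo 0 1) :
    wiltonSubSemiBrjuno x = gaussSeries deltaKernel x := by
  obtain ⟨B, hB⟩ := exists_abs_gaussSeries_deltaKernel_le
  have hx01 := Set.Ioo_subset_Ico_self hx.2
  have hwilton := tendsto_orbitProd_mul_wilton hx.1.1 hx01 hx.1.2.1
  have hbrjuno := tendsto_orbitProd_mul_semiBrjuno hx
  have hbrjuno_neg := tendsto_orbitProd_mul_semiBrjuno_neg hx.1.1 hx.2 hx.1.2.2.2.2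
  have hseries := (tendsto_orbitProd_mul_of_abs_le hB hx01).comp
    (tendsto_id.const_mul_atTop' two_pos)
  have hlim := ((hwilton.sub hbrjuno).add hbrjuno_neg).sub hseries
  rw [sub_self, add_zero, sub_zero] at hlim
  refine sub_eq_zero.1 (tendsto_nhds_unique (tendsto_const_nhds.congr fun m => ?_) hlim)
  rw [eq_neg_one_pow_mul_orbitProd_mul_iterate mapsTo_gaussMap_deltaMinusDomain
    (fun _ => wiltonSubSemiBrjuno_sub_gaussSeries_eq) hx (2 * m), (even_two_mul m).neg_one_pow,
    wiltonSubSemiBrjuno, Function.comp_apply, id]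
  ring

lemma wiltonSubSemiBrjuno_eq_gaussSeries (hx : x ∈ deltaMinusDomain) :
    wiltonSubSemiBrjuno x = gaussSeries deltaKernel x := by
  rw [← wiltonSubSemiBrjuno_fract, ← gaussSeries_fract]
  exact wiltonSubSemiBrjuno_eq_gaussSeries_of_mem_Ioo
    ⟨fract_mem_deltaMinusDomain_iff.2 hx, fract_mem_Ioo hx.1⟩

/-- The continuous extension of `Δ⁻` from `deltaMinusDomain` to the irrational numbers. -/
noncomputable def deltaMinusExt (x : ℝ) : ℝ :=
  gaussSeries deltaKernel x - wiltonEven ‖(x : UnitAddCircle)‖ / 2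

lemma deltaMinusExt_eq_deltaMinus (hx : x ∈ deltaMinusDomain) :
    deltaMinusExt x = deltaMinus x := by
  rw [deltaMinusExt, ← wiltonSubSemiBrjuno_eq_gaussSeries hx, wiltonSubSemiBrjuno, deltaMinus,
    oddPart, oddPart, wilton_neg hx.1 hx.2.1]
  ring

lemma exists_abs_deltaMinusExt_le : ∃ B, ∀ x, |deltaMinusExt x| ≤ B := by
  obtain ⟨B, hB⟩ := exists_abs_gaussSeries_deltaKernel_le
  obtain ⟨C, hC⟩ := exists_abs_wiltonEven_norm_le
  refine ⟨B + C / 2, fun x => (abs_sub _ _).trans (add_le_add (hB x) ?_)⟩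
  rw [abs_div, abs_two]
  exact div_le_div_of_nonneg_right (hC x) two_pos.le

lemma continuousOn_deltaMinusExt : ContinuousOn deltaMinusExt {x | Irrational x} := by
  obtain ⟨M, hM⟩ := exists_forall_mem_Ico_abs_le continuousOn_deltaKernel
  exact (continuousOn_gaussSeries (continuousOn_deltaKernel.mono Set.Ioo_subset_Icc_self) hM).sub
    (continuous_wiltonEven_norm.div_const 2).continuousOn

lemma exists_hasSideLimitsWithin_deltaMinusExt (q : ℚ) :
    ∃ l r, HasSideLimitsWithin deltaMinusExt {x | Irrational x} q l r ∧ r - l = 2 / q.den := by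
  obtain ⟨l, r, hl, hr, hlr⟩ :=
    exists_tendsto_gaussSeries_nhdsLT_nhdsGT continuousOn_deltaKernel q
  have heven := (continuous_wiltonEven_norm.div_const 2).tendsto (q : ℝ)
  refine ⟨_, _, ⟨(hl.sub (heven.mono_left nhdsWithin_le_nhds)).mono_left ?_,
    (hr.sub (heven.mono_left nhdsWithin_le_nhds)).mono_left ?_⟩, ?_⟩
  · exact nhdsWithin_mono _ Set.inter_subset_right
  · exact nhdsWithin_mono _ Set.inter_subset_right
  · rw [sub_sub_sub_cancel_right, hlr, deltaKernel_zero, deltaKernel_one]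
    norm_num

end Extension

theorem theorem2 :
    Dense deltaMinusDomain ∧
    ∃ (D : ℝ → ℝ) (l r : ℚ → ℝ),
      (∀ x ∈ deltaMinusDomain, D x = deltaMinus x) ∧
      ContinuousOn D {x | Irrational x} ∧
      (∀ s : ℚ,
        Tendsto D (𝓝[{x | Irrational x ∧ x < s}] (s : ℝ)) (𝓝 (l s)) ∧
        Tendsto D (𝓝[{x | Irrational x ∧ (s : ℝ) < x}] (s : ℝ)) (𝓝 (r s)) ∧
        r s - l s = 2 / (s.den : ℝ)) ∧
      (∀ F : ℝ → ℝ, (∀ x, Irrational x → F x = D x) →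
        (∀ s : ℚ, F s ∈ Set.Icc (l s) (r s)) →
        ∀ (a b : ℝ) (hab : a < b), RiemannIntegrableOn F a b hab) ∧
      (∀ F : ℝ → ℝ, (∀ x, Irrational x → F x = D x) →
        ∀ x : ℝ, ¬ DifferentiableWithinAt ℝ F {y | Irrational y} x) := by
  refine ⟨dense_deltaMinusDomain, ?_⟩
  choose l r hlr hjump using exists_hasSideLimitsWithin_deltaMinusExt
  obtain ⟨B, hB⟩ := exists_abs_deltaMinusExt_le
  refine ⟨deltaMinusExt, l, r, fun x hx => deltaMinusExt_eq_deltaMinus hx,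
    continuousOn_deltaMinusExt, fun q => ⟨(hlr q).left, (hlr q).right, hjump q⟩, ?_, ?_⟩
  · intro F hF hFlr a b hab
    have hirr : ∀ᵐ x : ℝ, Irrational x :=
      (Set.countable_range ((↑) : ℚ → ℝ)).ae_notMem MeasureTheory.volume
    refine riemannIntegrableOn_of_mem_Icc_sideLimits hab hirr (continuousOn_deltaMinusExt.congr hF)
      (fun x hx => (hF x hx).symm ▸ hB x) fun x hx => ?_
    obtain ⟨q, rfl⟩ := not_not.1 hx
    exact ⟨l q, r q, (hlr q).congr fun x hx => (hF x hx).symm, hFlr q⟩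
  · intro F hF
    exact not_differentiableWithinAt_of_jump_eq_div_den dense_irrational two_ne_zero
      fun q => ⟨l q, r q, (hlr q).congr fun x hx => (hF x hx).symm, hjump q⟩
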